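/- Let $I=[0,1]$. For a topological space $Y$, let $\hat Y=C(I;Y)/\!\sim$, where $C(I;Y)$ is the space of continuous maps $I\to Y$ with the compact-open topology, $\alpha\sim\beta$ means that $\alpha$ and $\beta$ are homotopic as paths relative to their endpoints, and $\hat Y$ carries the quotient topology. Let $p=(p_0,p_1):\hat Y\to Y\times Y$, $p([\gamma])=(\gamma(0),\gamma(1))$. A connected, locally path connected Hausdorff space $Y$ that admits a universal covering is called \emph{path representable} if $p_0$ and $p_1$ are homotopic as maps $\hat Y\to Y$. For a group $G$, a path connected space $Y$ is called a $K(G,1)$ if its fundamental group is isomorphic to $G$ and it has a contractible universal covering space. \textbf{Proposition.} Let $Y$ be a path connected (Hausdorff) CW complex with countably many cells that is a $K(G,1)$ for some group $G$. Then $Y$ is path representable; that is, $Y$ is connected, locally path connected and Hausdorff, it admits a universal covering, and the maps $p_0,p_1:\hat Y\to Y$ are homotopic. -/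

import Mathlib

universe u v

/-- Two paths `α β : [0,1] → Y` are related if they are homotopic through paths with the same
endpoints. -/
def pathHomotopySetoid (Y : Type u) [TopologicalSpace Y] : Setoid C(unitInterval, Y) where
  r α β := ContinuousMap.HomotopicRel α β {0, 1}
  iseqv := ContinuousMap.HomotopicRel.equivalence

/-- The diagonal cover of `Y`: the space `C([0,1], Y)` of all paths in `Y` with the compact-open
topology, modulo endpoint-preserving homotopy, with the quotient topology. -/
def DiagonalCover (Y : Type u) [TopologicalSpace Y] : Type u :=
  Quotient (pathHomotopySetoid Y)

instance (Y : Type u) [TopologicalSpace Y] : TopologicalSpace (DiagonalCover Y) :=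
  inferInstanceAs (TopologicalSpace (Quotient (pathHomotopySetoid Y)))

/-- The projection `p : [γ] ↦ (γ(0), γ(1))` of the diagonal cover to `Y × Y`. -/
def DiagonalCover.proj (Y : Type u) [TopologicalSpace Y] : C(DiagonalCover Y, Y × Y) where
  toFun := Quotient.lift (fun γ : C(unitInterval, Y) => (γ 0, γ 1)) (by
    rintro α β ⟨H⟩
    exact Prod.ext (H.fst_eq_snd (by simp)) (H.fst_eq_snd (by simp)))
  continuous_toFun := Continuous.quotient_lift (by fun_prop) _

/-- The first component `p₀ : [γ] ↦ γ(0)` of the projection. -/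
def DiagonalCover.proj₀ (Y : Type u) [TopologicalSpace Y] : C(DiagonalCover Y, Y) :=
  ContinuousMap.fst.comp (DiagonalCover.proj Y)

/-- The second component `p₁ : [γ] ↦ γ(1)` of the projection. -/
def DiagonalCover.proj₁ (Y : Type u) [TopologicalSpace Y] : C(DiagonalCover Y, Y) :=
  ContinuousMap.snd.comp (DiagonalCover.proj Y)

/-- `q : E → Y` is a universal covering: a surjective covering map with simply connected total
space. -/
structure IsUniversalCovering {E Y : Type u} [TopologicalSpace E] [TopologicalSpace Y]
    (q : E → Y) : Prop where
  isCoveringMap : IsCoveringMap q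
  surjective : Function.Surjective q
  simplyConnected : SimplyConnectedSpace E

/-- A path representable space: a connected, locally path connected Hausdorff space which admits a
universal covering and for which the two component maps of the projection
`p = (p₀, p₁) : DiagonalCover Y → Y × Y` are (freely) homotopic. -/
structure PathRepresentable (Y : Type u) [TopologicalSpace Y] : Prop where
  t2 : T2Space Y
  connected : ConnectedSpace Y
  locPathConnected : LocallyPathConnectedSpace Y
  exists_universalCovering :
    ∃ (E : Type u) (_ : TopologicalSpace E) (q : E → Y), IsUniversalCovering q
  homotopic : ContinuousMap.Homotopic (DiagonalCover.proj₀ Y) (DiagonalCover.proj₁ Y)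

/-- `Y` is a `K(G,1)`: it is path connected, its fundamental group is isomorphic to `G`, and it has
a contractible universal covering space. -/
structure IsKG1 (G : Type v) [Group G] (Y : Type u) [TopologicalSpace Y] : Prop where
  pathConnected : PathConnectedSpace Y
  fundamentalGroup : ∀ y : Y, Nonempty (FundamentalGroup Y y ≃* G)
  exists_contractible_universalCovering :
    ∃ (E : Type u) (_ : TopologicalSpace E) (q : E → Y),
      IsUniversalCovering q ∧ ContractibleSpace E

/-! The constant paths give a section `s` of `p₀` with `p₁ ∘ s = id`. So it suffices to show that
the identity of `Ŷ` is homotopic to `s ∘ p₀`: composing with `p₁` gives `p₁ ≃ p₁ ∘ s ∘ p₀ = p₀`.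

Let `q : E → Y` be the contractible universal covering. Over an open set with a local section `τ` of
`q`, a class `[γ]` is determined by `γ(0)` and the endpoint of the lift of `γ` from `τ(γ(0))`, since
`E` is simply connected. Contracting `E` moves this endpoint to a fixed point and thus shrinks each
fibre of `p₀` to a point (`DiagonalCover.exists_local_deformation`).

These local deformations are glued as in Dold's theorem (`homotopic_id_section_comp`): they are
damped by a locally finite sequence of bump functions and composed in order. The bump functions
exist because countably many cells make `Y` normal and Lindelöf. -/

section

open Set Filter
open scoped Topology unitInterval

/-! ### Normality from a compact exhaustion -/

/-- In a Hausdorff space, disjoint compact subsets of a compact set `K` have disjoint compact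
neighbourhoods relative to `K`. -/
theorem IsCompact.exists_disjoint_compact_nhds {X : Type*} [TopologicalSpace X] [T2Space X]
    {K C D : Set X} (hK : IsCompact K) (hC : IsCompact C) (hD : IsCompact D)
    (hCD : Disjoint C D) :
    ∃ C' D' : Set X, IsCompact C' ∧ IsCompact D' ∧ Disjoint C' D' ∧ C' ⊆ K ∧ D' ⊆ K ∧
      (∃ U, IsOpen U ∧ C ⊆ U ∧ U ∩ K ⊆ C') ∧ ∃ V, IsOpen V ∧ D ⊆ V ∧ V ∩ K ⊆ D' := by
  obtain ⟨U, V, hU, hV, hCU, hDV, hUV⟩ := SeparatedNhds.of_isCompact_isCompact hC hD hCD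
  have hC' : IsCompact (K \ V) := hK.diff hV
  -- A single separation does not suffice: `K \ V` and `K \ U` may meet outside `U ∪ V`. Separating
  -- `K \ V` itself from `D` makes the second set avoid the first.
  obtain ⟨U₂, V₂, hU₂, hV₂, hCU₂, hDV₂, hUV₂⟩ := SeparatedNhds.of_isCompact_isCompact hC' hD
    (disjoint_left.2 fun x hx hxD => hx.2 (hDV hxD))
  exact ⟨K \ V, K \ U₂, hC', hK.diff hU₂, disjoint_left.2 fun x hx hx' => hx'.2 (hCU₂ hx),
    sdiff_subset, sdiff_subset,
    ⟨U, hU, hCU, fun x hx => ⟨hx.2, disjoint_left.1 hUV hx.1⟩⟩,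
    ⟨V₂, hV₂, hDV₂, fun x hx => ⟨hx.2, disjoint_right.1 hUV₂ hx.1⟩⟩⟩

/-- If `C n` grows inside compact sets `K n` that determine the topology, in such a way that each
`C n` lies in the interior of `C (n + 1)` relative to `K (n + 1)`, then the union is open. -/
theorem isOpen_iUnion_of_subset_relative_interior {X : Type*} [TopologicalSpace X]
    {K C : ℕ → Set X} (hmono : Monotone K)
    (hweak : ∀ A, (∀ n, IsClosed (A ∩ K n)) → IsClosed A)
    (hK : ∀ n, IsClosed (K n)) (hCK : ∀ n, C n ⊆ K n)
    (hC : ∀ n, ∃ U, IsOpen U ∧ C n ⊆ U ∧ U ∩ K (n + 1) ⊆ C (n + 1)) :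
    IsOpen (⋃ n, C n) := by
  choose U hU hCU hUC using hC
  have hCmono : Monotone C := monotone_nat_of_le_succ fun n x hx =>
    hUC n ⟨hCU n hx, hmono n.le_succ (hCK n hx)⟩
  rw [← isClosed_compl_iff]
  refine hweak _ fun m => ?_
  -- Only the tail `n ≥ m` is usable: `U n` is controlled only inside `K (n + 1)`, which then
  -- contains `K m`.
  have : (⋃ n, C n)ᶜ ∩ K m = ⋂ n ∈ Ici m, (U n)ᶜ ∩ K m := by
    ext x
    simp only [mem_inter_iff, mem_compl_iff, mem_iUnion, not_exists, mem_iInter, mem_Ici]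
    refine ⟨fun h n hn => ⟨fun hx => h.1 (n + 1) (hUC n ⟨hx, ?_⟩), h.2⟩,
      fun h => ⟨fun n hx => ?_, (h m le_rfl).2⟩⟩
    · exact hmono (hn.trans n.le_succ) h.2
    · exact (h _ (le_max_right n m)).1 (hCU _ (hCmono (le_max_left n m) hx))
  rw [this]
  exact isClosed_biInter fun n _ => (hU n).isClosed_compl.inter (hK m)

/-- A Hausdorff space whose topology is determined by an increasing sequence of compact subsets
is normal. -/
theorem NormalSpace.of_compact_exhaustion {X : Type*} [TopologicalSpace X] [T2Space X]
    (K : ℕ → Set X) (hK : ∀ n, IsCompact (K n)) (hmono : Monotone K) (hcover : ⋃ n, K n = univ)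
    (hweak : ∀ A, (∀ n, IsClosed (A ∩ K n)) → IsClosed A) : NormalSpace X := by
  refine ⟨fun A B hA hB hAB => ?_⟩
  let Good (n : ℕ) (P : Set X × Set X) : Prop :=
    IsCompact P.1 ∧ IsCompact P.2 ∧ Disjoint P.1 P.2 ∧ P.1 ⊆ K n ∧ P.2 ⊆ K n ∧
      A ∩ K n ⊆ P.1 ∧ B ∩ K n ⊆ P.2
  have step (n : ℕ) (P : {P // Good n P}) : ∃ Q : {Q // Good (n + 1) Q},
      (∃ U, IsOpen U ∧ P.1.1 ⊆ U ∧ U ∩ K (n + 1) ⊆ Q.1.1) ∧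
      ∃ V, IsOpen V ∧ P.1.2 ⊆ V ∧ V ∩ K (n + 1) ⊆ Q.1.2 := by
    obtain ⟨⟨C, D⟩, hC, hD, hCD, hCK, hDK, hAC, hBD⟩ := P
    dsimp only at *
    have hle : K n ⊆ K (n + 1) := hmono n.le_succ
    -- The enlarged sets stay disjoint: `D` lies in `K n`, and `A` meets `K n` only inside `C`;
    -- likewise with the roles exchanged.
    obtain ⟨C', D', hC', hD', hCD', hCK', hDK', ⟨U, hU, hCU, hUC⟩, V, hV, hDV, hVD⟩ :=
      (hK (n + 1)).exists_disjoint_compact_nhds (C := C ∪ A ∩ K (n + 1)) (D := D ∪ B ∩ K (n + 1))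
        (hC.union ((hK _).inter_left hA)) (hD.union ((hK _).inter_left hB))
        (by
          rw [disjoint_union_left, disjoint_union_right, disjoint_union_right]
          refine ⟨⟨hCD, disjoint_left.2 fun x hx hx' => ?_⟩,
            disjoint_left.2 fun x hx hx' => ?_, hAB.mono inter_subset_left inter_subset_left⟩
          · exact disjoint_left.1 hCD hx (hBD ⟨hx'.1, hCK hx⟩)
          · exact disjoint_left.1 hCD (hAC ⟨hx.1, hDK hx'⟩) hx')
    exact ⟨⟨(C', D'), hC', hD', hCD', hCK', hDK',
      fun x hx => hUC ⟨hCU (Or.inr hx), hx.2⟩, fun x hx => hVD ⟨hDV (Or.inr hx), hx.2⟩⟩,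
      ⟨U, hU, subset_union_left.trans hCU, hUC⟩, V, hV, subset_union_left.trans hDV, hVD⟩
  choose next hnextl hnextr using step
  let P : ∀ n, {P // Good n P} := fun n => Nat.rec
    ⟨(A ∩ K 0, B ∩ K 0), (hK 0).inter_left hA, (hK 0).inter_left hB,
      hAB.mono inter_subset_left inter_subset_left, inter_subset_right, inter_subset_right,
      Subset.rfl, Subset.rfl⟩ next n
  have hKc n := (hK n).isClosed
  have hsub {S : Set X} {F : ℕ → Set X} (h : ∀ n, S ∩ K n ⊆ F n) : S ⊆ ⋃ n, F n := fun x hx => by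
    obtain ⟨n, hn⟩ := mem_iUnion.1 (hcover.symm ▸ mem_univ x)
    exact mem_iUnion.2 ⟨n, h n ⟨hx, hn⟩⟩
  have hmonoC : Monotone fun n => (P n).1.1 := monotone_nat_of_le_succ fun n x hx => by
    obtain ⟨U, -, h₁, h₂⟩ := hnextl n (P n)
    exact h₂ ⟨h₁ hx, hmono n.le_succ ((P n).2.2.2.2.1 hx)⟩
  have hmonoD : Monotone fun n => (P n).1.2 := monotone_nat_of_le_succ fun n x hx => by
    obtain ⟨U, -, h₁, h₂⟩ := hnextr n (P n)
    exact h₂ ⟨h₁ hx, hmono n.le_succ ((P n).2.2.2.2.2.1 hx)⟩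
  refine ⟨⋃ n, (P n).1.1, ⋃ n, (P n).1.2,
    isOpen_iUnion_of_subset_relative_interior hmono hweak hKc (fun n => (P n).2.2.2.2.1)
      fun n => hnextl n (P n),
    isOpen_iUnion_of_subset_relative_interior hmono hweak hKc (fun n => (P n).2.2.2.2.2.1)
      fun n => hnextr n (P n),
    hsub fun n => (P n).2.2.2.2.2.2.1, hsub fun n => (P n).2.2.2.2.2.2.2, ?_⟩
  simp only [disjoint_iUnion_left, disjoint_iUnion_right]
  exact fun m n => (P (max n m)).2.2.2.1.mono (hmonoC (le_max_left _ _))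
    (hmonoD (le_max_right _ _))

/-! ### Locally finite bump functions -/

/-- In a normal Lindelöf `T₁` space, every open neighbourhood assignment admits a countable,
locally finite family of subordinate bump functions whose plateaus cover the space. -/
theorem exists_locallyFinite_bump_sequence {X : Type*} [TopologicalSpace X] [T1Space X]
    [NormalSpace X] [LindelofSpace X] [Nonempty X] (U : X → Set X) (hU : ∀ x, IsOpen (U x))
    (hxU : ∀ x, x ∈ U x) :
    ∃ (c : ℕ → X) (μ : ℕ → C(X, I)), (∀ n, ∃ F ⊆ U (c n), IsClosed F ∧ ∀ x ∉ F, μ n x = 0) ∧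
      (∀ x, ∃ N, ∀ᶠ y in 𝓝 x, ∀ n ≥ N, μ n y = 0) ∧ ∀ x, ∃ n, μ n x = 1 := by
  have hbump (x : X) : ∃ f : C(X, ℝ), f x = 1 ∧ (∀ y, f y ∈ Icc (0 : ℝ) 1) ∧
      ∃ F ⊆ U x, IsClosed F ∧ ∀ y ∉ F, f y = 0 := by
    obtain ⟨f, h₀, h₁, h⟩ := exists_continuous_zero_one_of_isClosed (hU x).isClosed_compl
      (isClosed_singleton (x := x)) (by simpa using hxU x)
    have hfx : f x = 1 := h₁ rfl
    -- Truncating at height `1/2` makes the function vanish off a closed set contained in `U x`, not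
    -- merely off `U x`.
    refine ⟨⟨fun y => max 0 (2 * f y - 1), by fun_prop⟩, ?_, fun y => ⟨le_max_left _ _, ?_⟩,
      f ⁻¹' Ici (1 / 2), fun y hy => ?_, isClosed_Ici.preimage f.continuous, fun y hy => ?_⟩
    · simp [hfx]; norm_num
    · have := (h y).2
      exact max_le zero_le_one (by linarith)
    · by_contra hyU
      have : f y = 0 := h₀ hyU
      simp only [mem_preimage, mem_Ici, this] at hy
      norm_num at hy
    · simp only [mem_preimage, mem_Ici, not_le] at hy
      exact max_eq_left (by linarith)
  choose f hfx hf01 F hFU hF hfF using hbump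
  obtain ⟨c, hc⟩ := isLindelof_univ.indexed_countable_subcover (fun x => {y | 0 < f x y})
    (fun x => isOpen_lt continuous_const (f x).continuous)
    fun x _ => mem_iUnion.2 ⟨x, by simp [hfx]⟩
  let S : X → ℝ := fun y => ∑' n, (1 / 4 : ℝ) ^ n * f (c n) y
  have hle (n y) : (1 / 4 : ℝ) ^ n * f (c n) y ≤ (1 / 4) ^ n :=
    mul_le_of_le_one_right (by positivity) (hf01 _ y).2
  have hnn (n y) : 0 ≤ (1 / 4 : ℝ) ^ n * f (c n) y :=
    mul_nonneg (by positivity) (hf01 _ y).1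
  have hgeom : Summable fun n : ℕ => (1 / 4 : ℝ) ^ n :=
    summable_geometric_of_lt_one (by norm_num) (by norm_num)
  have hsum (y) : Summable fun n => (1 / 4 : ℝ) ^ n * f (c n) y :=
    hgeom.of_nonneg_of_le (fun n => hnn n y) fun n => hle n y
  have hScont : Continuous S := continuous_tsum (fun n => by fun_prop) hgeom fun n y => by
    rw [Real.norm_of_nonneg (hnn n y)]; exact hle n y
  have hSpos (y) : 0 < S y := by
    obtain ⟨n, hn⟩ := mem_iUnion.1 (hc (mem_univ y))
    exact (hsum y).tsum_pos (fun n => hnn n y) n (mul_pos (by positivity) hn)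
  -- Local finiteness: `g n ≤ 0` as soon as `2 ^ n * S ≥ 8`, which holds near any point for all
  -- large `n`. Plateaus: if every `g n x < 1`, then `f (c n) x < 2 ^ n * S x / 4`, and summing with
  -- weights `4⁻ⁿ` gives `S x ≤ S x / 2`, contradicting `S x > 0`.
  let g (n : ℕ) (y : X) : ℝ := 8 * f (c n) y / (2 ^ n * S y) - 1
  have hg (n) : Continuous (g n) :=
    (Continuous.div (by fun_prop) (by fun_prop) fun y => by
      have := hSpos y; positivity).sub continuous_const
  have hg0 {n y} (h : g n y ≤ 0) : projIcc (0 : ℝ) 1 zero_le_one (g n y) = 0 :=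
    projIcc_of_le_left _ h
  refine ⟨c, fun n => ⟨fun y => projIcc 0 1 zero_le_one (g n y),
    continuous_projIcc.comp (hg n)⟩, fun n => ⟨F (c n), hFU _, hF _, fun y hy => hg0 ?_⟩,
    fun x => ?_, fun x => ?_⟩
  · simp [g, hfF _ _ hy]
  · obtain ⟨N, hN⟩ := exists_nat_gt (16 / S x)
    refine ⟨N, (hScont.continuousAt.eventually (lt_mem_nhds (half_lt_self (hSpos x)))).mono
      fun y hy n hn => hg0 ?_⟩
    have h2 : (n : ℝ) < 2 ^ n := by exact_mod_cast n.lt_two_pow_self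
    have hn' : (N : ℝ) ≤ n := by exact_mod_cast hn
    have h16 : 16 < 2 ^ n * S x := by
      rw [div_lt_iff₀ (hSpos x)] at hN
      exact hN.trans (mul_lt_mul_of_pos_right (hn'.trans_lt h2) (hSpos x))
    have h8 : 8 < 2 ^ n * S y := by
      have : 2 ^ n * (S x / 2) < 2 ^ n * S y := mul_lt_mul_of_pos_left hy (by positivity)
      linarith
    have : 8 * f (c n) y / (2 ^ n * S y) ≤ 1 := by
      rw [div_le_one (by linarith)]
      linarith [(hf01 (c n) y).2]
    simp only [g]; linarith
  · by_contra! hne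
    have hlt (n : ℕ) : (1 / 4 : ℝ) ^ n * f (c n) x ≤ (1 / 2) ^ n * (S x / 4) := by
      have h1 : g n x < 1 := by
        by_contra! h
        exact hne n (projIcc_of_right_le zero_le_one h)
      have h2 : 8 * f (c n) x / (2 ^ n * S x) < 2 := by simp only [g] at h1; linarith
      have := hSpos x
      rw [div_lt_iff₀ (by positivity)] at h2
      have h4 : (1 / 4 : ℝ) ^ n = (1 / 2) ^ n * (1 / 2) ^ n := by rw [← mul_pow]; norm_num
      have h5 : (1 / 2 : ℝ) ^ n * 2 ^ n = 1 := by rw [← mul_pow]; norm_num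
      calc (1 / 4 : ℝ) ^ n * f (c n) x ≤ (1 / 4 : ℝ) ^ n * (2 ^ n * S x / 4) :=
            mul_le_mul_of_nonneg_left (by linarith) (by positivity)
        _ = (1 / 2) ^ n * ((1 / 2) ^ n * 2 ^ n) * (S x / 4) := by rw [h4]; ring
        _ = _ := by rw [h5, mul_one]
    have h := (hsum x).tsum_le_tsum hlt (summable_geometric_two.mul_right _)
    rw [tsum_mul_right, tsum_geometric_two] at h
    have := hSpos x
    change S x ≤ _ at h
    linarith

/-! ### Topology of CW complexes -/

section CW

open Topology

variable {Y : Type*} [TopologicalSpace Y] [T2Space Y] [CWComplex (univ : Set Y)]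

/-- A CW complex with countably many cells is σ-compact and normal. -/
theorem Topology.CWComplex.sigmaCompactSpace_and_normalSpace
    (hcells : Countable (Σ n : ℕ, RelCWComplex.cell (univ : Set Y) n)) :
    SigmaCompactSpace Y ∧ NormalSpace Y := by
  obtain ⟨e, he⟩ := Countable.exists_injective_nat (Σ n : ℕ, RelCWComplex.cell (univ : Set Y) n)
  let K (N : ℕ) : Set Y := ⋃ i ∈ e ⁻¹' Iic N, RelCWComplex.closedCell i.1 i.2
  have hsub (i) : RelCWComplex.closedCell i.1 i.2 ⊆ K (e i) :=
    subset_biUnion_of_mem (u := fun i : Σ n, RelCWComplex.cell (univ : Set Y) n =>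
      RelCWComplex.closedCell i.1 i.2) (show i ∈ e ⁻¹' Iic (e i) from le_refl (e i))
  have hK (N) : IsCompact (K N) := ((finite_Iic N).preimage he.injOn).isCompact_biUnion
    fun i _ => RelCWComplex.isCompact_closedCell
  have hmono : Monotone K := fun M N h => biUnion_subset_biUnion_left fun i hi => le_trans hi h
  have hcover : ⋃ N, K N = univ := by
    refine eq_univ_of_forall fun y => ?_
    have hy : y ∈ ⋃ (n : ℕ) (j : RelCWComplex.cell (univ : Set Y) n),
      RelCWComplex.closedCell n j := by
        rw [CWComplex.union (C := (univ : Set Y))]; exact mem_univ y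
    simp only [mem_iUnion] at hy
    obtain ⟨n, j, hj⟩ := hy
    exact mem_iUnion.2 ⟨_, hsub ⟨n, j⟩ hj⟩
  refine ⟨⟨K, hK, hcover⟩, .of_compact_exhaustion K hK hmono hcover fun A hA => ?_⟩
  refine (CWComplex.closed (univ : Set Y) A (subset_univ A)).2 fun n j => ?_
  have : A ∩ RelCWComplex.closedCell n j =
      A ∩ K (e ⟨n, j⟩) ∩ RelCWComplex.closedCell n j := by
    rw [inter_assoc, inter_eq_right.2 (hsub ⟨n, j⟩)]
  exact this ▸ (hA _).inter RelCWComplex.isClosed_closedCell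

/-- CW complexes are locally path connected. -/
theorem Topology.CWComplex.locallyPathConnectedSpace : LocallyPathConnectedSpace Y := by
  -- The characteristic maps present `Y` as a quotient of a disjoint union of convex balls, and
  -- local path connectedness passes to quotients.
  let Z := Σ i : (Σ n : ℕ, RelCWComplex.cell (univ : Set Y) n),
    Metric.closedBall (0 : Fin i.1 → ℝ) 1
  have (i : Σ n : ℕ, RelCWComplex.cell (univ : Set Y) n) :
      LocallyPathConnectedSpace (Metric.closedBall (0 : Fin i.1 → ℝ) 1) :=
    (convex_closedBall _ _).locallyPathConnectedSpace
  let φ : Z → Y := fun z => RelCWComplex.map z.1.1 z.1.2 z.2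
  have hφ : Continuous φ := continuous_sigma fun i =>
    (RelCWComplex.continuousOn i.1 i.2).domRestrict
  have hclosed (A : Set Y) (hA : IsClosed (φ ⁻¹' A)) : IsClosed A := by
    refine (CWComplex.closed (univ : Set Y) A (subset_univ A)).2 fun n j => ?_
    have hc := isClosed_sigma_iff.1 hA ⟨n, j⟩
    have himg := (hc.isCompact.image (RelCWComplex.continuousOn (C := univ) n j).domRestrict).isClosed
    convert! himg using 1
    ext y
    constructor
    · rintro ⟨hy, x, hx, rfl⟩
      exact ⟨⟨x, hx⟩, hy, rfl⟩
    · rintro ⟨⟨x, hx⟩, hy, rfl⟩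
      exact ⟨hy, x, hx, rfl⟩
  have hcoind : ‹TopologicalSpace Y› = .coinduced φ inferInstance :=
    le_antisymm (fun s hs => by
      rw [← isClosed_compl_iff]
      exact hclosed _ (isOpen_coinduced.1 hs).isClosed_compl) hφ.coinduced_le
  rw [hcoind]
  exact LocallyPathConnectedSpace.coinduced φ

end CW

/-! ### Gluing fibrewise deformations -/

/-- A fibrewise deformation over an open set, damped by a bump function, extends by the identity to
a global fibrewise deformation. -/
theorem exists_damped_deformation {X B : Type*} [TopologicalSpace X] [TopologicalSpace B]
    {p : X → B} (hp : Continuous p) {U F : Set B} (hU : IsOpen U) (hF : IsClosed F) (hFU : F ⊆ U)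
    {K : X × I → X} (hK : ContinuousOn K ((p ⁻¹' U) ×ˢ univ))
    (hK₀ : ∀ z, p z ∈ U → K (z, 0) = z) (hKp : ∀ z t, p z ∈ U → p (K (z, t)) = p z)
    (hK₁ : ∀ z z', p z ∈ U → p z = p z' → K (z, 1) = K (z', 1))
    (μ : C(B, I)) (hμ : ∀ b ∉ F, μ b = 0) :
    ∃ T : C(X × I, X), (∀ z, T (z, 0) = z) ∧ (∀ z t, p (T (z, t)) = p z) ∧
      (∀ z t, μ (p z) = 0 → T (z, t) = z) ∧
      ∀ z z', μ (p z) = 1 → p z = p z' → T (z, 1) = T (z', 1) := by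
  classical
  -- The local deformation is run only up to time `t * μ`. It is stationary off `F`, so the two
  -- formulas agree on the overlap of the preimages of `U` and `Fᶜ`.
  let T : X × I → X := fun w => if p w.1 ∈ U then K (w.1, w.2 * μ (p w.1)) else w.1
  have hT₀ (z t) (h : μ (p z) = 0) : T (z, t) = z := by
    by_cases hz : p z ∈ U <;> simp [T, hz, h, hK₀]
  refine ⟨⟨T, continuous_iff_continuousAt.2 fun ⟨z, t⟩ => ?_⟩, fun z => ?_, fun z t => ?_, hT₀,
    fun z z' h₁ hz => ?_⟩
  · by_cases hz : p z ∈ U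
    · have hopen : IsOpen {w : X × I | p w.1 ∈ U} := hU.preimage (hp.comp continuous_fst)
      refine ContinuousOn.continuousAt (s := {w : X × I | p w.1 ∈ U}) ?_ (hopen.mem_nhds hz)
      refine ContinuousOn.congr (f := fun w : X × I => K (w.1, w.2 * μ (p w.1))) ?_
        fun w hw => if_pos hw
      exact hK.comp (Continuous.continuousOn (by fun_prop)) fun w hw => ⟨hw, mem_univ _⟩
    · have hopen : IsOpen {w : X × I | p w.1 ∈ Fᶜ} :=
        hF.isOpen_compl.preimage (hp.comp continuous_fst)
      refine continuousAt_fst.congr (mem_of_superset (hopen.mem_nhds fun h => hz (hFU h)) ?_)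
      rintro ⟨w, s⟩ hw
      exact (hT₀ w s (hμ _ hw)).symm
  · by_cases hz : p z ∈ U <;> simp [T, hz, hK₀]
  · by_cases hz : p z ∈ U <;> simp [T, hz, hKp]
  · have hzU : p z ∈ U := hFU <| by
      by_contra h
      rw [hμ _ h] at h₁
      exact zero_ne_one h₁
    simpa [T, hzU, hz ▸ hzU, h₁, hz ▸ h₁] using hK₁ z z' hzU hz

/-- Composing a locally finite sequence of fibrewise deformations, one of which collapses each
fibre, gives a deformation that collapses all fibres. -/
theorem exists_deformation_collapsing_fibres {X B : Type*} [TopologicalSpace X]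
    [TopologicalSpace B] {p : X → B} (hp : Continuous p) (μ : ℕ → B → I)
    (hfin : ∀ b, ∃ N, ∀ᶠ y in 𝓝 b, ∀ n ≥ N, μ n y = 0) (hone : ∀ b, ∃ n, μ n b = 1)
    (T : ℕ → C(X × I, X)) (hT₀ : ∀ n z, T n (z, 0) = z) (hTp : ∀ n z t, p (T n (z, t)) = p z)
    (hTμ : ∀ n z t, μ n (p z) = 0 → T n (z, t) = z)
    (hT₁ : ∀ n z z', μ n (p z) = 1 → p z = p z' → T n (z, 1) = T n (z', 1)) :
    ∃ H : C(X × I, X), (∀ z, H (z, 0) = z) ∧ ∀ z z', p z = p z' → H (z, 1) = H (z', 1) := by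
  -- `P n` applies the first `n` deformations successively, all at the same time `t`. Near each
  -- fibre the sequence is eventually constant, so its stable value `H` is continuous.
  let P : ℕ → C(X × I, X) := fun n =>
    Nat.rec ContinuousMap.fst (fun n Q => (T n).comp (Q.prodMk ContinuousMap.snd)) n
  have hP (n z t) : P (n + 1) (z, t) = T n (P n (z, t), t) := rfl
  have hPp (n z t) : p (P n (z, t)) = p z := by
    induction n with
    | zero => rfl
    | succ n ih => rw [hP, hTp, ih]
  have hP₀ (n z) : P n (z, 0) = z := by
    induction n with
    | zero => rfl
    | succ n ih => rw [hP, hT₀, ih]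
  have hstable {N z} (h : ∀ n ≥ N, μ n (p z) = 0) {n} (hn : N ≤ n) (t) :
      P n (z, t) = P N (z, t) := by
    induction n, hn using Nat.le_induction with
    | base => rfl
    | succ n hn ih => rw [hP, hTμ _ _ _ (by rw [hPp, h n hn]), ih]
  choose N hN using hfin
  let H : X × I → X := fun w => P (N (p w.1)) w
  have hH {z n} (hn : N (p z) ≤ n) (t) : P n (z, t) = H (z, t) :=
    hstable (hN (p z)).self_of_nhds hn t
  refine ⟨⟨H, continuous_iff_continuousAt.2 fun ⟨z, t⟩ => ?_⟩, fun z => hP₀ _ z,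
    fun z z' hz => ?_⟩
  · refine (P (N (p z))).continuous.continuousAt.congr ?_
    have hc : ContinuousAt (fun w : X × I => p w.1) (z, t) := by fun_prop
    refine (hc.eventually (hN (p z))).mono fun ⟨y, s⟩ hy => ?_
    rw [← hH (le_max_right (N (p z)) _) s, hstable hy (le_max_left _ _)]
  · obtain ⟨n, hn⟩ := hone (p z)
    -- Once stage `n` has identified two points of a fibre, later stages keep them identified.
    have hcol {m} (hm : n + 1 ≤ m) : P m (z, 1) = P m (z', 1) := by
      induction m, hm using Nat.le_induction with
      | base => exact hT₁ n _ _ (by rw [hPp, hn]) (by rw [hPp, hPp, hz])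
      | succ m hm ih => rw [hP, hP, ih]
    change H (z, 1) = H (z', 1)
    rw [← hH (le_max_right (n + 1) _) 1, ← hH (n := max (n + 1) (N (p z))) (by simp [hz]) 1,
      hcol (le_max_left _ _)]

/-- A map over a normal Lindelöf base that is locally shrinkable over the base deforms onto the
image of any of its sections. -/
theorem homotopic_id_section_comp {X B : Type*} [TopologicalSpace X]
    [TopologicalSpace B] [T1Space B] [NormalSpace B] [LindelofSpace B] [Nonempty B]
    (p : C(X, B)) (s : C(B, X)) (hs : ∀ b, p (s b) = b)
    (hloc : ∀ b, ∃ U, IsOpen U ∧ b ∈ U ∧ ∃ K : X × I → X, ContinuousOn K ((p ⁻¹' U) ×ˢ univ) ∧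
      (∀ z, p z ∈ U → K (z, 0) = z) ∧ (∀ z t, p z ∈ U → p (K (z, t)) = p z) ∧
      ∀ z z', p z ∈ U → p z = p z' → K (z, 1) = K (z', 1)) :
    (ContinuousMap.id X).Homotopic (s.comp p) := by
  choose U hU hbU K hK hK₀ hKp hK₁ using hloc
  obtain ⟨c, μ, hsupp, hfin, hone⟩ := exists_locallyFinite_bump_sequence U hU hbU
  choose F hFU hF hμ using hsupp
  choose T hT₀ hTp hTμ hT₁ using fun n => exists_damped_deformation p.continuous (hU (c n)) (hF n)
    (hFU n) (hK (c n)) (hK₀ (c n)) (hKp (c n)) (hK₁ (c n)) (μ n) (hμ n)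
  obtain ⟨H, hH₀, hH₁⟩ := exists_deformation_collapsing_fibres p.continuous (fun n => μ n) hfin hone
    T hT₀ hTp hTμ hT₁
  let h : C(X, X) := H.comp ((ContinuousMap.id X).prodMk (.const X 1))
  have hid : (ContinuousMap.id X).Homotopic h :=
    ⟨{ toContinuousMap := H.comp ContinuousMap.prodSwap
       map_zero_left := fun z => hH₀ z
       map_one_left := fun z => rfl }⟩
  -- `h` is constant on fibres, and `s (p z)` lies in the fibre of `z`. Hence `s ∘ p ≃ h ∘ s ∘ p = h
  -- ≃ id`, although the deformation need not fix the section.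
  have hsp : h.comp (s.comp p) = h := by
    ext z
    exact hH₁ _ _ (hs _)
  have := hid.comp (.refl (s.comp p))
  rw [hsp] at this
  exact hid.trans this.symm

/-! ### Paths in contractible and simply connected spaces -/

/-- In a contractible space one can choose a path between any two points, continuously in the
endpoints. -/
theorem exists_continuous_path_choice (E : Type*) [TopologicalSpace E] [ContractibleSpace E] :
    ∃ N : C(E × E, C(I, E)), ∀ w, N w 0 = w.1 ∧ N w 1 = w.2 := by
  obtain ⟨e₀, ⟨c⟩⟩ := id_nullhomotopic E
  let γ (a : E) : Path a e₀ := ⟨⟨fun t => c (t, a), by fun_prop⟩, by simp, by simp⟩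
  have hγ : Continuous fun w : E × I => γ w.1 w.2 := by
    change Continuous fun w : E × I => c (w.2, w.1)
    fun_prop
  have h := Path.trans_continuous_family (ι := E × E) (fun w => γ w.1)
    (hγ.comp (by fun_prop : Continuous fun w : (E × E) × I => (w.1.1, w.2)))
    (fun w => (γ w.2).symm)
    (hγ.comp (by fun_prop : Continuous fun w : (E × E) × I => (w.1.2, σ w.2)))
  let f : C((E × E) × I, E) := ⟨_, h⟩
  exact ⟨f.curry, fun w => ⟨((γ w.1).trans (γ w.2).symm).source,
    ((γ w.1).trans (γ w.2).symm).target⟩⟩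

/-- In a simply connected space, paths with the same endpoints are homotopic relative to them. -/
theorem SimplyConnectedSpace.homotopicRel_of_endpoints {E : Type*} [TopologicalSpace E]
    [SimplyConnectedSpace E] {α β : C(I, E)} (h₀ : α 0 = β 0) (h₁ : α 1 = β 1) :
    α.HomotopicRel β {0, 1} :=
  SimplyConnectedSpace.paths_homotopic (⟨α, rfl, rfl⟩ : Path (α 0) (α 1)) ⟨β, h₀.symm, h₁.symm⟩

/-! ### Local shrinkability of the diagonal cover -/

namespace DiagonalCover

variable {Y : Type u} [TopologicalSpace Y]

/-- The class of a path in the diagonal cover. -/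
def mk : C(C(I, Y), DiagonalCover Y) :=
  ⟨Quotient.mk (pathHomotopySetoid Y), continuous_quotient_mk'⟩

theorem isQuotientMap_mk : Topology.IsQuotientMap (mk (Y := Y)) := isQuotientMap_quotient_mk'

theorem mk_eq_mk {α β : C(I, Y)} (h : α.HomotopicRel β {0, 1}) : mk α = mk β :=
  Quotient.sound h

/-- The section of both projections given by the constant paths. -/
def const : C(Y, DiagonalCover Y) :=
  mk.comp (ContinuousMap.curry ContinuousMap.fst)

theorem proj₀_const (y : Y) : proj₀ Y (const y) = y := rfl

/-- Over an open set with a section `τ` to a covering space `E`, lifting paths along `τ` and taking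
the endpoint is continuous on the diagonal cover. -/
theorem exists_continuousOn_endpoint_of_lift {E : Type u} [TopologicalSpace E] {q : E → Y}
    (hq : IsCoveringMap q) {U : Set Y} (hU : IsOpen U) {τ : Y → E} (hτ : ContinuousOn τ U)
    (hqτ : ∀ y ∈ U, q (τ y) = y) :
    ∃ L : DiagonalCover Y → E, ContinuousOn L (proj₀ Y ⁻¹' U) ∧
      ∀ z, proj₀ Y z ∈ U → ∃ Γ : C(I, E), Γ 0 = τ (proj₀ Y z) ∧ Γ 1 = L z ∧
        mk (.comp ⟨q, hq.continuous⟩ Γ) = z := by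
  classical
  -- The second branch is a default for paths that cannot be lifted from `τ (γ 0)`. It depends only
  -- on `γ 0`, so `ℓ` still descends to homotopy classes.
  let ℓ (γ : C(I, Y)) : E := if h : γ 0 = q (τ (γ 0)) then hq.liftPath γ (τ (γ 0)) h 1 else τ (γ 0)
  have hℓ (α β : C(I, Y)) (h : α.HomotopicRel β {0, 1}) : ℓ α = ℓ β := by
    have h₀ : α 0 = β 0 := h.some.fst_eq_snd (by simp)
    by_cases hα : α 0 = q (τ (α 0))
    · have hβ : β 0 = q (τ (β 0)) := h₀ ▸ hα
      simp only [ℓ, dif_pos hα, dif_pos hβ]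
      simp only [← h₀]
      exact hq.liftPath_apply_one_eq_of_homotopicRel h _ _ _
    · have hβ : ¬ β 0 = q (τ (β 0)) := h₀ ▸ hα
      simp only [ℓ, dif_neg hα, dif_neg hβ, h₀]
  refine ⟨Quotient.lift ℓ hℓ, ?_, fun z => ?_⟩
  · refine (isQuotientMap_mk.continuousOn_isOpen_iff (g := (Quotient.lift ℓ hℓ : _ → E))
      (hU.preimage (proj₀ Y).continuous)).2 ?_
    change ContinuousOn ℓ {γ : C(I, Y) | γ 0 ∈ U}
    rw [continuousOn_iff_continuous_domRestrict]
    let A := {γ : C(I, Y) | γ 0 ∈ U}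
    -- Evaluation turns all of `A` into one homotopy `I × A → Y`. Lifting it as a whole shows that
    -- the endpoints vary continuously.
    let ev : C(I × A, Y) := ⟨fun w => w.2.1 w.1, by fun_prop⟩
    let f : C(A, E) := ⟨fun γ => τ (γ.1 0), hτ.comp_continuous (by fun_prop) fun γ => γ.2⟩
    have hf (γ : A) : ev (0, γ) = q (f γ) := (hqτ _ γ.2).symm
    have : Continuous fun γ : A => hq.liftHomotopy ev f hf (1, γ) := by fun_prop
    refine this.congr fun γ => ?_
    have hγ : γ.1 0 = q (τ (γ.1 0)) := hf γ
    simp only [domRestrict_apply, ℓ, dif_pos hγ]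
    rfl
  · induction z using Quotient.inductionOn with
    | h γ =>
    intro hz
    have hγ : γ 0 = q (τ (γ 0)) := (hqτ _ hz).symm
    refine ⟨hq.liftPath γ (τ (γ 0)) hγ, hq.liftPath_zero _ _ _, ?_, ?_⟩
    · change _ = ℓ γ
      simp only [ℓ, dif_pos hγ]
    · exact congrArg mk (ContinuousMap.ext fun t => congrFun (hq.liftPath_lifts γ _ hγ) t)

/-- If the universal covering space of `Y` is contractible, then the first projection of the
diagonal cover is locally shrinkable over `Y`. -/
theorem exists_local_deformation {E : Type u} [TopologicalSpace E] {q : E → Y}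
    (hq : IsUniversalCovering q) [ContractibleSpace E] (y : Y) :
    ∃ U, IsOpen U ∧ y ∈ U ∧ ∃ K : DiagonalCover Y × I → DiagonalCover Y,
      ContinuousOn K ((proj₀ Y ⁻¹' U) ×ˢ univ) ∧
      (∀ z, proj₀ Y z ∈ U → K (z, 0) = z) ∧
      (∀ z t, proj₀ Y z ∈ U → proj₀ Y (K (z, t)) = proj₀ Y z) ∧
      ∀ z z', proj₀ Y z ∈ U → proj₀ Y z = proj₀ Y z' → K (z, 1) = K (z', 1) := by
  have := hq.simplyConnected
  obtain ⟨e, rfl⟩ := hq.surjective y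
  obtain ⟨φ, heφ, hφ⟩ := hq.isCoveringMap.isLocalHomeomorph e
  have hqφ (b) (hb : b ∈ φ.target) : q (φ.symm b) = b := by
    have := φ.right_inv hb
    rwa [← hφ] at this
  obtain ⟨L, hL, hlift⟩ := exists_continuousOn_endpoint_of_lift hq.isCoveringMap φ.open_target
    φ.continuousOn_symm hqφ
  obtain ⟨N, hN⟩ := exists_continuous_path_choice E
  obtain ⟨e₀, ⟨c⟩⟩ := id_nullhomotopic E
  let qc : C(E, Y) := ⟨q, hq.isCoveringMap.continuous⟩
  let D : E × E → DiagonalCover Y := fun w => mk (qc.comp (N w))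
  have hD : Continuous D := by fun_prop
  -- At time `t` the class is the projection of a path in `E` from the lifted start point to `c (t,
  -- L z)`. At `t = 0` simple connectedness returns `z`; at `t = 1` the endpoint is `e₀`, so only
  -- `proj₀ Y z` matters.
  refine ⟨φ.target, φ.open_target, by rw [hφ]; exact φ.map_source heφ,
    fun w => D (φ.symm (proj₀ Y w.1), c (w.2, L w.1)), ?_, fun z hz => ?_, fun z t hz => ?_,
    fun z z' hz hzz' => ?_⟩
  · have h₁ : ContinuousOn (fun w : DiagonalCover Y × I => φ.symm (proj₀ Y w.1))
        ((proj₀ Y ⁻¹' φ.target) ×ˢ univ) :=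
      φ.continuousOn_symm.comp (by fun_prop) fun w hw => hw.1
    have h₂ : ContinuousOn (fun w : DiagonalCover Y × I => L w.1)
        ((proj₀ Y ⁻¹' φ.target) ×ˢ univ) := hL.comp (by fun_prop) fun w hw => hw.1
    exact hD.comp_continuousOn (h₁.prodMk (c.continuous.comp_continuousOn
      (continuous_snd.continuousOn.prodMk h₂)))
  · obtain ⟨Γ, h₀, h₁, hΓ⟩ := hlift z hz
    refine Eq.trans (mk_eq_mk ?_) hΓ
    refine (SimplyConnectedSpace.homotopicRel_of_endpoints ?_ ?_).map
      fun H => H.compContinuousMap qc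
    · rw [(hN _).1, h₀]
    · rw [(hN _).2, h₁]
      exact c.map_zero_left _
  · change q (N _ 0) = _
    rw [(hN _).1, hqφ _ hz]
  · have hc (x) : c (1, x) = e₀ := c.map_one_left x
    simp only [hc, hzz']

end DiagonalCover

end

theorem mainTheorem10 {G : Type v} [Group G] {Y : Type u} [TopologicalSpace Y] [T2Space Y]
    [Topology.CWComplex (Set.univ : Set Y)]
    (hcells : Countable (Σ n : ℕ, Topology.RelCWComplex.cell (Set.univ : Set Y) n))
    (hY : IsKG1 G Y) :
    PathRepresentable Y := by
  have := hY.pathConnected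
  obtain ⟨E, _, q, hq, _⟩ := hY.exists_contractible_universalCovering
  obtain ⟨_, _⟩ := Topology.CWComplex.sigmaCompactSpace_and_normalSpace hcells
  refine ⟨inferInstance, inferInstance, Topology.CWComplex.locallyPathConnectedSpace,
    ⟨E, _, q, hq⟩, ?_⟩
  have h := homotopic_id_section_comp (DiagonalCover.proj₀ Y) DiagonalCover.const
    DiagonalCover.proj₀_const (DiagonalCover.exists_local_deformation hq)
  -- Composing with `proj₁` suffices because `proj₁ ∘ const` is definitionally the identity.
  exact ((ContinuousMap.Homotopic.refl (DiagonalCover.proj₁ Y)).comp h).symm
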